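/- Let $\mathscr R$ be a nontrivial bipotent semifield without zero (equivalently, a totally ordered abelian group, written multiplicatively, with $\alpha\dotplus\beta=\max(\alpha,\beta)$) that is divisible, archimedean and conditionally complete. Let $\mathscr R(x_1,\dots,x_n)$, $n\ge 0$, be the semifield of quotients of polynomials, i.e. of nonempty finite sums of monomials $c\,x_1^{k_1}\cdots x_n^{k_n}$ ($c\in\mathscr R$, $k_i\in\mathbb Z_{\ge0}$), regarded as functions $\mathscr R^n\to\mathscr R$ with pointwise operations and order. Write $|f|=f\dotplus f^{-1}$. A kernel is a subgroup $K$ of $\mathscr R(x_1,\dots,x_n)$ such that $xa\dotplus yb\in K$ whenever $a,b\in K$ and $x\dotplus y=1$. $\langle A\rangle$ is the smallest kernel containing $A$, a kernel $\langle f\rangle$ is principal, $f\sim f'$ means $\langle f\rangle=\langle f'\rangle$, and $Skel(f)=\{x\in\mathscr R^n: f(x)=1\}$. Empty products of kernels are $\langle 1\rangle$ and empty sums $\sum|f_i|$ are $1$. * An HP-fraction is an $f\sim h/g$ with $h\ne g$ monomials and $\langle h/g\rangle\cap\mathscr R\subseteq\{1\}$; it generates an HP-kernel. * An HS-fraction is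 an $f\sim\sum_{i=1}^t|f_i|$, $t\ge 0$, with each $f_i=h_i/g_i$ for monomials $h_i\neq g_i$ with $\langle h_i/g_i\rangle\cap\mathscr R\subseteq\{1\}$; it generates an HS-kernel. * An order-fraction is $o=1\dotplus g$ with $g\neq1$ an HP-fraction; it generates an order kernel. A region-fraction is an $r\sim\sum_{i=1}^t|o_i|$, $t\ge0$, with order-fractions $o_i=1\dotplus g_i$ such that $1\dotplus g_j\ne 1\dotplus g_i^{-1}$ for all $i,j$ and such that $Skel(r)$ contains a nonempty open box; it generates a region kernel. * A principal kernel is bounded from below if it has a generator $f$ with $|f|\ge\alpha$ for some constant $\alpha>1$. * $f$ is regular if it can be written $f=h/g$, with $h=\sum h_i$, $g=\sum g_j$ sums of monomials, such that for each $x\in\mathscr R^n$ there are $i,j$ with $h(x)=h_i(x)$, $g(x)=g_j(x)$ and $h_i\ne g_j$. A principal kernel is regular if it has a regular generator, and irregular otherwise. **Theorem.** Every principal kernel $\langle f\rangle$ of $\mathscr R(x_1,\dots,x_n)$ can be written as $$\langle f\rangle=\bigcap_{i=1}^{s}K_i\cap\bigcap_{j=1}^{m}N_j\qquad(s,m\ge0)\qquad(*)$$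 with principal kernels $K_i=L_i\cdot R_i$, where $L_i=\prod_{j=1}^{t_i}L_{j,i}$ is an HS-kernel with a given factorization into HP-kernels ($t_i\ge0$) and $R_i=\prod_{l=1}^{v_i}O_{l,i}$ is a region kernel with a given factorization into order kernels ($v_i\ge0$), and principal kernels $N_j=B_j\cdot Q_j$, where $B_j$ is bounded from below and $Q_j$ is a region kernel. Moreover: 1. If $\langle f\rangle\subseteq\langle\mathscr R\rangle$, then in every decomposition $(*)$ the $N_j$ can be replaced by $\langle\mathscr R\rangle$ without changing the intersection. 2. If $\langle f\rangle$ is an HS-kernel, there is a decomposition $(*)$ with $s=1$, $m=0$, no order kernels, and $\langle f\rangle=K_1=L_1$. 3. If $\langle f\rangle$ is a region kernel, there is a decomposition $(*)$ with $s=1$, $m=0$, no HP-kernels, and $\langle f\rangle=K_1=R_1$. 4. For every decomposition $(*)$: $\langle f\rangle$ is irregular if and only if $K_{i_0}=R_{i_0}$ for some $i_0\in\{1,\dots,s\}$. 5. For every decomposition $(*)$: $\langle f\rangle$ is regular if and only if every $K_i$ has at least one HP-kernel among its given factors, i.e. $t_i\ge1$ for every $i=1,\dots,s$. -/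

import Mathlib

/-! ### Idempotent semifields and their kernels

An idempotent (commutative) semifield without zero is the same thing as a commutative
lattice-ordered group; its addition is the join `⊔`. -/

section Kernels

variable {S : Type*} [CommGroup S] [Lattice S]

/-- A (semifield-)kernel: a subgroup `K` such that `x + y = 1` and `a, b ∈ K` imply
`x a + y b ∈ K`. -/
def IsKernel (K : Subgroup S) : Prop :=
  ∀ x y : S, x ⊔ y = 1 → ∀ a ∈ K, ∀ b ∈ K, x * a ⊔ y * b ∈ K

/-- The kernel generated by a set: the intersection of all kernels containing it. -/
def kerSpan (A : Set S) : Subgroup S :=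
  sInf {K : Subgroup S | IsKernel K ∧ A ⊆ K}

/-- The principal kernel `⟨f⟩`.  Throughout, the product of two kernels is their
join `⊔` as subgroups (equal to the product set, since the group is commutative). -/
def ker (f : S) : Subgroup S := kerSpan {f}

theorem isKernel_kerSpan (A : Set S) : IsKernel (kerSpan A) := by
  intro x y hxy a ha b hb
  rw [kerSpan, Subgroup.mem_sInf] at *
  intro K hK
  exact hK.1 x y hxy a (ha K hK) b (hb K hK)

/-- `K` is a principal kernel. -/
def IsPrincipalKernel (K : Subgroup S) : Prop := ∃ f : S, K = ker f

/-- The finite sum `∑ |a|` over a list, where `|a| = a + a⁻¹`.  The summand `1` is absorbed as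
soon as the list is nonempty (all `|a| ≥ 1`); for the empty list it gives the value `1`. -/
def absSum (l : List S) : S := l.foldr (fun a s => |a|ₘ ⊔ s) 1

end Kernels

/-! ### The semifield of fractions `R(x₁, …, xₙ)`, as a semifield of functions on `Rⁿ` -/

section Fractions

variable {n : ℕ} {R : Type*} [CommGroup R] [LinearOrder R]

set_option linter.unusedSectionVars false

/-- Monomials `c x₁^{k₁} ⋯ xₙ^{kₙ}` with `c ∈ R`, `kᵢ ∈ ℕ`. -/
def IsTropMonomial (m : (Fin n → R) → R) : Prop :=
  ∃ (c : R) (k : Fin n → ℕ), m = fun x => c * ∏ i, x i ^ k i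

/-- `H` is a nonempty finite set of monomials and `p = ∑_{h ∈ H} h`. -/
def IsTropPolySum (p : (Fin n → R) → R) (H : Finset ((Fin n → R) → R)) : Prop :=
  (∀ h ∈ H, IsTropMonomial h) ∧ ∃ hH : H.Nonempty, p = H.sup' hH id

/-- Polynomials: the elements of `R[x₁, …, xₙ]` (without zero), as functions. -/
def IsTropPoly (p : (Fin n → R) → R) : Prop := ∃ H, IsTropPolySum p H

theorem IsTropMonomial.mul {p q : (Fin n → R) → R} (hp : IsTropMonomial p) (hq : IsTropMonomial q) :
    IsTropMonomial (p * q) := by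
  obtain ⟨c, k, rfl⟩ := hp
  obtain ⟨d, l, rfl⟩ := hq
  refine ⟨c * d, k + l, ?_⟩
  funext x
  simp only [Pi.mul_apply, Pi.add_apply, pow_add, Finset.prod_mul_distrib]
  exact mul_mul_mul_comm _ _ _ _

theorem IsTropMonomial.isTropPoly {p : (Fin n → R) → R} (hp : IsTropMonomial p) : IsTropPoly p :=
  ⟨{p}, by simpa using hp, Finset.singleton_nonempty p, by simp⟩

theorem isTropPoly_one : IsTropPoly (1 : (Fin n → R) → R) :=
  IsTropMonomial.isTropPoly ⟨1, 0, by funext x; simp⟩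

open Classical in
theorem IsTropPoly.sup {p q : (Fin n → R) → R} (hp : IsTropPoly p) (hq : IsTropPoly q) :
    IsTropPoly (p ⊔ q) := by
  obtain ⟨H, hH, hne, rfl⟩ := hp
  obtain ⟨G, hG, hne', rfl⟩ := hq
  refine ⟨H ∪ G, ?_, hne.mono Finset.subset_union_left, ?_⟩
  · intro h hh
    rcases Finset.mem_union.1 hh with h1 | h1
    exacts [hH h h1, hG h h1]
  · rw [Finset.sup'_union hne hne']

variable [IsOrderedMonoid R]

open Classical in
theorem IsTropPoly.mul {p q : (Fin n → R) → R} (hp : IsTropPoly p) (hq : IsTropPoly q) :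
    IsTropPoly (p * q) := by
  obtain ⟨H, hH, hne, rfl⟩ := hp
  obtain ⟨G, hG, hne', rfl⟩ := hq
  refine ⟨Finset.image₂ (· * ·) H G, ?_, hne.image₂ hne', ?_⟩
  · intro h hh
    obtain ⟨a, ha, b, hb, rfl⟩ := Finset.mem_image₂.1 hh
    exact (hH a ha).mul (hG b hb)
  · apply le_antisymm
    · intro x
      obtain ⟨a, ha, hax⟩ := Finset.exists_mem_eq_sup' hne (fun h : (Fin n → R) → R => h x)
      obtain ⟨b, hb, hbx⟩ := Finset.exists_mem_eq_sup' hne' (fun h : (Fin n → R) → R => h x)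
      simp only [Pi.mul_apply, Finset.sup'_apply, id_eq]
      rw [hax, hbx]
      exact Finset.le_sup' (fun h : (Fin n → R) → R => h x)
        (Finset.mem_image₂_of_mem (f := (· * ·)) ha hb)
    · refine Finset.sup'_le _ _ ?_
      intro h hh
      obtain ⟨a, ha, b, hb, rfl⟩ := Finset.mem_image₂.1 hh
      intro x
      exact mul_le_mul' (Finset.le_sup' (f := id) ha x) (Finset.le_sup' (f := id) hb x)

variable (n R) in
/-- The multiplicative group of all fractions `p / q` of polynomials, inside all functions
`Rⁿ → R`. -/
def fracSubgroup : Subgroup ((Fin n → R) → R) where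
  carrier := {f | ∃ p q, IsTropPoly p ∧ IsTropPoly q ∧ f = p / q}
  one_mem' := ⟨1, 1, isTropPoly_one, isTropPoly_one, by simp⟩
  mul_mem' := by
    rintro _ _ ⟨p, q, hp, hq, rfl⟩ ⟨p', q', hp', hq', rfl⟩
    exact ⟨p * p', q * q', hp.mul hp', hq.mul hq', div_mul_div_comm _ _ _ _⟩
  inv_mem' := by
    rintro _ ⟨p, q, hp, hq, rfl⟩
    exact ⟨q, p, hq, hp, inv_div _ _⟩

variable (n R) in
/-- The semifield `R(x₁, …, xₙ)`. -/
abbrev Frac : Type _ := ↥(fracSubgroup n R)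

theorem fracSubgroup_sup_mem {f g : (Fin n → R) → R} (hf : f ∈ fracSubgroup n R)
    (hg : g ∈ fracSubgroup n R) : f ⊔ g ∈ fracSubgroup n R := by
  obtain ⟨p, q, hp, hq, rfl⟩ := hf
  obtain ⟨p', q', hp', hq', rfl⟩ := hg
  refine ⟨p * q' ⊔ p' * q, q * q', (hp.mul hq').sup (hp'.mul hq), hq.mul hq', ?_⟩
  funext x
  simp only [Pi.sup_apply, Pi.div_apply, Pi.mul_apply]
  rw [div_eq_mul_inv (_ ⊔ _), sup_mul, ← div_eq_mul_inv, ← div_eq_mul_inv,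
    mul_div_mul_right_eq_div, mul_comm (q x) (q' x), mul_div_mul_right_eq_div]

theorem fracSubgroup_inf_mem {f g : (Fin n → R) → R} (hf : f ∈ fracSubgroup n R)
    (hg : g ∈ fracSubgroup n R) : f ⊓ g ∈ fracSubgroup n R := by
  have h := inv_mem (fracSubgroup_sup_mem (inv_mem hf) (inv_mem hg))
  rwa [inv_sup, inv_inv, inv_inv] at h

/-- The pointwise lattice structure; the addition of `R(x₁, …, xₙ)` is `⊔`. -/
instance : Lattice (Frac n R) :=
  Subtype.lattice (fun {_ _} => fracSubgroup_sup_mem) (fun {_ _} => fracSubgroup_inf_mem)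

theorem IsTropPoly.mem_frac {p : (Fin n → R) → R} (hp : IsTropPoly p) : p ∈ fracSubgroup n R :=
  ⟨p, 1, hp, isTropPoly_one, by simp⟩

/-- The constant `α ∈ R ⊆ R(x₁, …, xₙ)`. -/
def constFrac (α : R) : Frac n R :=
  ⟨fun _ => α, IsTropPoly.mem_frac (IsTropMonomial.isTropPoly ⟨α, 0, by funext x; simp⟩)⟩

variable (n R) in
/-- The kernel `⟨R⟩` generated by the constants. -/
def constKer : Subgroup (Frac n R) := kerSpan (Set.range constFrac)

/-- The skeleton of a set of fractions. -/
def Skel (A : Set (Frac n R)) : Set (Fin n → R) := {x | ∀ f ∈ A, f.1 x = 1}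

/-! ### Hyperplane, hyperspace, order and region fractions -/

/-- `a = h / g` for distinct monomials `h, g`, and `⟨a⟩ ∩ R ⊆ {1}`. -/
def IsHPMonomial (a : Frac n R) : Prop :=
  (∃ h g : (Fin n → R) → R, IsTropMonomial h ∧ IsTropMonomial g ∧ h ≠ g ∧ a.1 = h / g) ∧
    ∀ α : R, constFrac α ∈ ker a → α = 1

/-- HP-fractions: `f ∼ h / g`, where `∼` means generating the same kernel. -/
def IsHPFraction (f : Frac n R) : Prop := ∃ a, IsHPMonomial a ∧ ker f = ker a

def IsHPKernel (K : Subgroup (Frac n R)) : Prop := ∃ f, IsHPFraction f ∧ K = ker f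

/-- HS-fractions: `f ∼ ∑ |fᵢ|` with `fᵢ = hᵢ / gᵢ` as in `IsHPMonomial`.  The empty sum is
allowed and means `1`. -/
def IsHSFraction (f : Frac n R) : Prop :=
  ∃ l : List (Frac n R), (∀ a ∈ l, IsHPMonomial a) ∧ ker f = ker (absSum l)

def IsHSKernel (K : Subgroup (Frac n R)) : Prop := ∃ f, IsHSFraction f ∧ K = ker f

/-- Order fractions `o = 1 + g`, with `g ≠ 1` an HP-fraction. -/
def IsOrderFraction (o : Frac n R) : Prop := ∃ g, IsHPFraction g ∧ g ≠ 1 ∧ o = 1 ⊔ g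

/-- A subset of `Rⁿ` is nondegenerate if it contains an open box. -/
def Nondegenerate (Z : Set (Fin n → R)) : Prop :=
  ∃ a b : Fin n → R, (∀ i, a i < b i) ∧ Set.univ.pi (fun i => Set.Ioo (a i) (b i)) ⊆ Z

/-- Region fractions: `r ∼ ∑ |oᵢ|` with order fractions `oᵢ = 1 + gᵢ`, no `oⱼ` being the
complementary order fraction `1 + gᵢ⁻¹` of some `oᵢ`, such that the region `Skel(r)` is a
nondegenerate polyhedron.  The empty sum is allowed and means `1`. -/
def IsRegionFraction (r : Frac n R) : Prop :=
  ∃ l : List (Frac n R), (∀ g ∈ l, IsHPFraction g ∧ g ≠ 1) ∧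
    (∀ g ∈ l, ∀ g' ∈ l, 1 ⊔ g' ≠ 1 ⊔ g⁻¹) ∧
    ker r = ker (absSum (l.map (fun g => 1 ⊔ g))) ∧
    Nondegenerate (Skel {r})

def IsRegionKernel (K : Subgroup (Frac n R)) : Prop := ∃ r, IsRegionFraction r ∧ K = ker r

/-- A principal kernel is bounded from below if some generator `f` satisfies `|f| ≥ α` for a
constant `α > 1`. -/
def IsBoundedBelowKernel (K : Subgroup (Frac n R)) : Prop :=
  ∃ f, K = ker f ∧ ∃ α : R, 1 < α ∧ constFrac α ≤ |f|ₘ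

/-- `f = h / g = (∑ hᵢ) / (∑ gⱼ)` is regular if at each point there are dominating monomials
`hᵢ`, `gⱼ` with `hᵢ ≠ gⱼ`. -/
def IsRegularFrac (f : Frac n R) : Prop :=
  ∃ (h g : (Fin n → R) → R) (H G : Finset ((Fin n → R) → R)),
    IsTropPolySum h H ∧ IsTropPolySum g G ∧ f.1 = h / g ∧
      ∀ x, ∃ h' ∈ H, ∃ g' ∈ G, h x = h' x ∧ g x = g' x ∧ h' ≠ g'

/-- Regular principal kernels. -/
def IsRegularKernel (K : Subgroup (Frac n R)) : Prop := ∃ f, IsRegularFrac f ∧ K = ker f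

/-- A decomposition of `M` as a finite intersection of principal kernels
`Kᵢ = Lᵢ · Rᵢ` (with `Rᵢ` called `Rg i`; an HS-kernel times a region kernel, with a factorization of `Lᵢ` into HP-kernels
and of `Rᵢ` into order kernels) and principal kernels `Nⱼ = Bⱼ · Qⱼ` (a bounded from below kernel
times a region kernel). -/
structure HODecomposition (M : Subgroup (Frac n R)) where
  s : ℕ
  m : ℕ
  L : Fin s → Subgroup (Frac n R)
  Rg : Fin s → Subgroup (Frac n R)
  B : Fin m → Subgroup (Frac n R)
  Q : Fin m → Subgroup (Frac n R)
  /-- generators of the HP-kernels whose product is `Lᵢ` -/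
  hp : Fin s → List (Frac n R)
  /-- generators of the order kernels whose product is `Rᵢ = Rg i` -/
  ord : Fin s → List (Frac n R)
  isHS_L : ∀ i, IsHSKernel (L i)
  isHP_hp : ∀ i, ∀ a ∈ hp i, IsHPFraction a
  L_eq : ∀ i, L i = ⨆ a ∈ hp i, ker a
  isRegion_Rg : ∀ i, IsRegionKernel (Rg i)
  isOrder_ord : ∀ i, ∀ o ∈ ord i, IsOrderFraction o
  Rg_eq : ∀ i, Rg i = ⨆ o ∈ ord i, ker o
  isBoundedBelow_B : ∀ j, IsBoundedBelowKernel (B j)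
  isRegion_Q : ∀ j, IsRegionKernel (Q j)
  isPrincipal_K : ∀ i, IsPrincipalKernel (L i ⊔ Rg i)
  isPrincipal_N : ∀ j, IsPrincipalKernel (B j ⊔ Q j)
  eq_inf : M = (⨅ i, L i ⊔ Rg i) ⊓ ⨅ j, B j ⊔ Q j

/-- The kernels `Kᵢ = Lᵢ · Rᵢ`. -/
def HODecomposition.K {M : Subgroup (Frac n R)} (D : HODecomposition M) (i : Fin D.s) :
    Subgroup (Frac n R) := D.L i ⊔ D.Rg i

end Fractions

/-! ### Kernels generated by one element, and their products. -/

section KernelTheory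

variable {S : Type*} [CommGroup S] [Lattice S]

/-! A principal kernel is a domination class: `mem_ker` says that `g` lies in `ker f` exactly when
`|g| ≤ |f| ^ N` for some `N`. So membership can be tested separately on finitely many pieces
covering the space.

For existence, write `f = p / q`, with `p` and `q` sums of monomials. The loci where given monomials
`h`, `g` dominate `p`, `q` are closed and cover the space, and those with nonempty interior already
do (`exists_mem_nonempty_interior`). On such a locus `f = h / g`, and the order fractions built from
the ratios `h' / h` and `g' / g` equal 1. Off it, these order fractions bound `p / h` and `q / g`.
Hence `ker f` is the intersection of the kernels `ker (h / g) ⊔ ker r`, with `r` the region fraction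
of the locus (`mem_ker_iff_forall_dominationLocus`). The quotient `h / g` is 1, a constant different
from 1, or an HP-fraction (`IsTropMonomial.const_or_isHPMonomial`); the second case gives the
bounded components, the others the components `Kᵢ`.

Regularity is topological: a principal kernel is regular iff its skeleton has empty interior
(`isRegularKernel_ker_iff`). The skeleton of an intersection lies in the union of the skeletons;
bounded components have empty skeleton, HP-kernels have nowhere dense skeleton, and region kernels
have a box in theirs. This settles regularity for every decomposition at once. -/

theorem IsKernel.sup_mem {K : Subgroup S} (hK : IsKernel K) {a b : S} (ha : a ∈ K) (hb : b ∈ K) :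
    a ⊔ b ∈ K := by
  simpa using hK 1 1 (sup_idem _) a ha b hb

theorem IsKernel.mabs_mem {K : Subgroup S} (hK : IsKernel K) {a : S} (ha : a ∈ K) : |a|ₘ ∈ K :=
  hK.sup_mem ha (inv_mem ha)

theorem isKernel_iInf {ι : Sort*} {K : ι → Subgroup S} (hK : ∀ i, IsKernel (K i)) :
    IsKernel (⨅ i, K i) := by
  intro x y hxy a ha b hb
  rw [Subgroup.mem_iInf] at *
  exact fun i => hK i x y hxy a (ha i) b (hb i)

theorem IsKernel.kerSpan_le {K : Subgroup S} (hK : IsKernel K) {A : Set S} (hA : A ⊆ K) :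
    kerSpan A ≤ K :=
  sInf_le ⟨hK, hA⟩

theorem mem_ker_self (f : S) : f ∈ ker f := by
  rw [ker, kerSpan, Subgroup.mem_sInf]
  exact fun K hK => hK.2 rfl

theorem isKernel_ker (f : S) : IsKernel (ker f) := isKernel_kerSpan _

theorem IsKernel.ker_le {K : Subgroup S} (hK : IsKernel K) {f : S} (hf : f ∈ K) : ker f ≤ K :=
  hK.kerSpan_le (by simpa using hf)

theorem mabs_le_absSum {l : List S} {a : S} (ha : a ∈ l) : |a|ₘ ≤ absSum l := by
  induction l with
  | nil => simp at ha
  | cons b l ih =>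
    rcases List.mem_cons.1 ha with rfl | h
    exacts [le_sup_left, (ih h).trans le_sup_right]

variable [IsOrderedMonoid S]

theorem IsKernel.mem_of_one_le {K : Subgroup S} (hK : IsKernel K) {a g : S} (ha : a ∈ K)
    (h1 : 1 ≤ g) (h2 : g ≤ a) : g ∈ K := by
  -- The combination `(g / a) * a ⊔ 1 * 1` is `g ⊔ 1 = g`.
  have := hK (g / a) 1 (sup_eq_right.2 (div_le_one'.2 h2)) a ha 1 (one_mem _)
  simpa [sup_eq_left.2 h1] using this

theorem IsKernel.mem_of_mabs_le {K : Subgroup S} (hK : IsKernel K) {a g : S} (ha : a ∈ K)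
    (h : |g|ₘ ≤ a) : g ∈ K := by
  have h0 : |g|ₘ ∈ K := hK.mem_of_one_le ha (one_le_mabs g) h
  -- `g * |g|` lies between 1 and `|g| * |g|`, so convexity above 1 applies; then divide by `|g|`.
  have h1 : g * |g|ₘ ∈ K := by
    refine hK.mem_of_one_le (mul_mem h0 h0) ?_ (mul_le_mul_left (le_mabs_self g) _)
    rw [← inv_le_iff_one_le_mul']
    exact inv_le_mabs g
  simpa using div_mem h1 h0

theorem mabs_le_iff_inv_le_and_le {a c : S} : |a|ₘ ≤ c ↔ c⁻¹ ≤ a ∧ a ≤ c := by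
  rw [mabs, sup_le_iff, inv_le', and_comm]

/-- Membership in a principal kernel. -/
theorem mem_ker {f g : S} : g ∈ ker f ↔ ∃ N : ℕ, |g|ₘ ≤ |f|ₘ ^ N := by
  constructor
  · let K : Subgroup S :=
      { carrier := {g | ∃ N : ℕ, |g|ₘ ≤ |f|ₘ ^ N}
        one_mem' := ⟨0, by simp⟩
        mul_mem' := by
          rintro a b ⟨M, hM⟩ ⟨N, hN⟩
          exact ⟨M + N, (mabs_mul_le a b).trans (by rw [pow_add]; exact mul_le_mul' hM hN)⟩
        inv_mem' := by
          rintro a ⟨M, hM⟩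
          exact ⟨M, by rwa [mabs_inv]⟩ }
    -- If `a`, `b` both lie between `C⁻¹` and `C`, then so does `x * a ⊔ y * b`, because `x * C ⊔ y
    -- * C = (x ⊔ y) * C = C`, and likewise for `C⁻¹`.
    have hK : IsKernel K := by
      rintro x y hxy a ⟨M, hM⟩ b ⟨N, hN⟩
      refine ⟨M + N, ?_⟩
      have h1 : |a|ₘ ≤ |f|ₘ ^ (M + N) :=
        hM.trans (pow_le_pow_right' (one_le_mabs f) (Nat.le_add_right _ _))
      have h2 : |b|ₘ ≤ |f|ₘ ^ (M + N) :=
        hN.trans (pow_le_pow_right' (one_le_mabs f) (Nat.le_add_left _ _))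
      rw [mabs_le_iff_inv_le_and_le] at h1 h2 ⊢
      constructor
      · calc (|f|ₘ ^ (M + N))⁻¹ = x * (|f|ₘ ^ (M + N))⁻¹ ⊔ y * (|f|ₘ ^ (M + N))⁻¹ := by
              rw [← sup_mul, hxy, one_mul]
          _ ≤ x * a ⊔ y * b := sup_le_sup (mul_le_mul_right h1.1 _) (mul_le_mul_right h2.1 _)
      · calc x * a ⊔ y * b ≤ x * |f|ₘ ^ (M + N) ⊔ y * |f|ₘ ^ (M + N) :=
              sup_le_sup (mul_le_mul_right h1.2 _) (mul_le_mul_right h2.2 _)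
          _ = |f|ₘ ^ (M + N) := by rw [← sup_mul, hxy, one_mul]
    intro hg
    exact hK.ker_le (f := f) ⟨1, by simp⟩ hg
  · rintro ⟨N, hN⟩
    exact (isKernel_ker f).mem_of_mabs_le (pow_mem ((isKernel_ker f).mabs_mem (mem_ker_self f)) N) hN

theorem ker_one : ker (1 : S) = ⊥ := by
  refine le_antisymm (fun g hg => ?_) bot_le
  obtain ⟨N, hN⟩ := mem_ker.1 hg
  have : |g|ₘ ≤ 1 := by simpa using hN
  rw [mabs_le_iff_inv_le_and_le] at this
  exact Subgroup.mem_bot.2 (le_antisymm this.2 (by simpa using this.1))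

/-- Riesz decomposition: split `u` into `u ⊓ |f| ^ N` and the remaining factor `1 ⊔ u / |f| ^ N`,
which is at most `|g| ^ N`. -/
theorem mem_of_ker_sup_ker_le {K : Subgroup S} {f g : S} (hK : ker f ⊔ ker g ≤ K) {u : S}
    {N : ℕ} (h1 : 1 ≤ u) (hu : u ≤ |f|ₘ ^ N * |g|ₘ ^ N) : u ∈ K := by
  have hf : |f|ₘ ^ N ∈ ker f := pow_mem ((isKernel_ker f).mabs_mem (mem_ker_self f)) N
  have hg : |g|ₘ ^ N ∈ ker g := pow_mem ((isKernel_ker g).mabs_mem (mem_ker_self g)) N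
  have hf1 : 1 ≤ |f|ₘ ^ N := one_le_pow_of_one_le' (one_le_mabs f) N
  have hg1 : 1 ≤ |g|ₘ ^ N := one_le_pow_of_one_le' (one_le_mabs g) N
  have e1 : u ⊓ |f|ₘ ^ N ∈ ker f := (isKernel_ker f).mem_of_one_le hf (le_inf h1 hf1) inf_le_right
  have e2 : u / (u ⊓ |f|ₘ ^ N) ∈ ker g := by
    refine (isKernel_ker g).mem_of_one_le hg (one_le_div'.2 inf_le_left) ?_
    rw [div_eq_mul_inv, inv_inf, mul_sup, mul_inv_cancel]
    refine sup_le hg1 ?_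
    rw [mul_inv_le_iff_le_mul, mul_comm]
    exact hu
  have := mul_mem (hK (Subgroup.mem_sup_left e1)) (hK (Subgroup.mem_sup_right e2))
  simpa using this

/-- The product of two principal kernels is principal. -/
theorem ker_sup_ker (f g : S) : ker f ⊔ ker g = ker (|f|ₘ ⊔ |g|ₘ) := by
  have h1 : 1 ≤ |f|ₘ ⊔ |g|ₘ := (one_le_mabs f).trans le_sup_left
  apply le_antisymm
  · refine sup_le ((isKernel_ker _).ker_le (mem_ker.2 ⟨1, ?_⟩))
      ((isKernel_ker _).ker_le (mem_ker.2 ⟨1, ?_⟩)) <;> rw [pow_one, mabs_of_one_le h1]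
    exacts [le_sup_left, le_sup_right]
  · intro u hu
    obtain ⟨N, hN⟩ := mem_ker.1 hu
    rw [mabs_of_one_le h1] at hN
    have hN' : |u|ₘ ≤ |f|ₘ ^ N * |g|ₘ ^ N := by
      refine hN.trans ?_
      rw [← mul_pow]
      refine pow_le_pow_left' (sup_le ?_ ?_) N
      exacts [le_mul_of_one_le_right' (one_le_mabs g), le_mul_of_one_le_left' (one_le_mabs f)]
    have e1 : |u|ₘ ∈ ker f ⊔ ker g := mem_of_ker_sup_ker_le le_rfl (one_le_mabs u) hN'
    -- Riesz decomposition needs elements above 1; a general `u` is the quotient of two such, `u *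
    -- |u|` and `|u|`.
    have e2 : u * |u|ₘ ∈ ker f ⊔ ker g := by
      refine mem_of_ker_sup_ker_le (f := f) (g := g) (N := N + N) le_rfl ?_ ?_
      · rw [← inv_le_iff_one_le_mul']
        exact inv_le_mabs u
      · calc u * |u|ₘ ≤ |u|ₘ * |u|ₘ := mul_le_mul_left (le_mabs_self u) _
          _ ≤ (|f|ₘ ^ N * |g|ₘ ^ N) * (|f|ₘ ^ N * |g|ₘ ^ N) := mul_le_mul' hN' hN'
          _ = |f|ₘ ^ (N + N) * |g|ₘ ^ (N + N) := by rw [pow_add, pow_add, mul_mul_mul_comm]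
    simpa using div_mem e2 e1

theorem one_le_absSum (l : List S) : 1 ≤ absSum l := by
  cases l with
  | nil => exact le_rfl
  | cons a l => exact (one_le_mabs a).trans le_sup_left

theorem ker_absSum (l : List S) : ker (absSum l) = ⨆ a ∈ l, ker a := by
  induction l with
  | nil => simp [absSum, ker_one]
  | cons a l ih =>
    have : absSum (a :: l) = |a|ₘ ⊔ |absSum l|ₘ := by
      rw [mabs_of_one_le (one_le_absSum l)]; rfl
    rw [this, ← ker_sup_ker, ih]
    simp [iSup_or, iSup_sup_eq]

end KernelTheory

/-! ### Pointwise description of kernels of fractions, and skeletons. -/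

section FracBasics

variable {n : ℕ} {R : Type*} [CommGroup R] [LinearOrder R] [IsOrderedMonoid R]

instance : IsOrderedMonoid (Frac n R) where
  mul_le_mul_left _ _ h c x := mul_le_mul_left (h x) (c.1 x)

theorem Frac.mabs_apply (f : Frac n R) (x : Fin n → R) : |f|ₘ.1 x = |f.1 x|ₘ := rfl

theorem Frac.sup_apply (f g : Frac n R) (x : Fin n → R) : (f ⊔ g).1 x = f.1 x ⊔ g.1 x := rfl

theorem Frac.div_apply (f g : Frac n R) (x : Fin n → R) : (f / g).1 x = f.1 x / g.1 x := rfl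

theorem mem_ker_iff_forall {f g : Frac n R} :
    g ∈ ker f ↔ ∃ N : ℕ, ∀ x, |g.1 x|ₘ ≤ |f.1 x|ₘ ^ N := by
  rw [mem_ker]; rfl

theorem mem_skel_ker {f : Frac n R} {x : Fin n → R} :
    x ∈ Skel (ker f : Set (Frac n R)) ↔ f.1 x = 1 := by
  refine ⟨fun h => h f (mem_ker_self f), fun h g hg => ?_⟩
  obtain ⟨N, hN⟩ := mem_ker_iff_forall.1 hg
  have := hN x
  rw [h, mabs_one, one_pow] at this
  exact mabs_eq_one.1 (le_antisymm this (one_le_mabs _))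

theorem skel_singleton (f : Frac n R) : Skel {f} = Skel (ker f : Set (Frac n R)) := by
  ext x
  rw [mem_skel_ker]
  simp [Skel]

theorem Skel.mono {A B : Set (Frac n R)} (h : A ⊆ B) : Skel B ⊆ Skel A :=
  fun _ hx f hf => hx f (h hf)

theorem skel_top [Nontrivial R] : Skel ((⊤ : Subgroup (Frac n R)) : Set (Frac n R)) = ∅ := by
  obtain ⟨α, hα⟩ := exists_ne (1 : R)
  exact Set.eq_empty_of_forall_notMem fun x hx => hα (hx (constFrac α) trivial)

/-- If `u ∈ A` and `v ∈ B` both differ from 1 at `x`, then `|u| ⊓ |v|` is in both kernels by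
convexity. Its value at `x` is one of `|u x|`, `|v x|` since `R` is linearly ordered, hence not 1.
-/
theorem mem_skel_inf {A B : Subgroup (Frac n R)} (hA : IsKernel A) (hB : IsKernel B)
    {x : Fin n → R} (hx : x ∈ Skel ((A ⊓ B : Subgroup (Frac n R)) : Set (Frac n R))) :
    x ∈ Skel (A : Set (Frac n R)) ∨ x ∈ Skel (B : Set (Frac n R)) := by
  by_contra! h
  simp only [Skel, Set.mem_ofPred_eq, not_forall] at h
  obtain ⟨⟨u, hu, hux⟩, v, hv, hvx⟩ := h
  have h1 : 1 ≤ |u|ₘ ⊓ |v|ₘ := le_inf (one_le_mabs u) (one_le_mabs v)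
  have h2 := hx (|u|ₘ ⊓ |v|ₘ) ⟨hA.mem_of_one_le (hA.mabs_mem hu) h1 inf_le_left,
    hB.mem_of_one_le (hB.mabs_mem hv) h1 inf_le_right⟩
  have h3 : |u.1 x|ₘ ⊓ |v.1 x|ₘ = 1 := h2
  rcases min_choice |u.1 x|ₘ |v.1 x|ₘ with h | h
  · exact hux (mabs_eq_one.1 (h.symm.trans h3))
  · exact hvx (mabs_eq_one.1 (h.symm.trans h3))

theorem mem_skel_iInf [Nontrivial R] {s : ℕ} {K : Fin s → Subgroup (Frac n R)}
    (hK : ∀ i, IsKernel (K i)) {x : Fin n → R}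
    (hx : x ∈ Skel ((⨅ i, K i : Subgroup (Frac n R)) : Set (Frac n R))) :
    ∃ i, x ∈ Skel (K i : Set (Frac n R)) := by
  induction s with
  | zero => rw [iInf_of_empty, skel_top] at hx; exact hx.elim
  | succ s ih =>
    have e : (⨅ i, K i) = K 0 ⊓ ⨅ i : Fin s, K i.succ := by
      refine le_antisymm (le_inf (iInf_le _ _) (le_iInf fun i => iInf_le _ _)) ?_
      refine le_iInf fun i => Fin.cases inf_le_left (fun j => inf_le_right.trans (iInf_le _ j)) i
    rw [e] at hx
    rcases mem_skel_inf (hK 0) (isKernel_iInf fun i : Fin s => hK i.succ) hx with h | h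
    · exact ⟨0, h⟩
    · obtain ⟨i, hi⟩ := ih (fun i : Fin s => hK i.succ) h
      exact ⟨i.succ, hi⟩

theorem IsBoundedBelowKernel.skel_eq_empty {B : Subgroup (Frac n R)}
    (hB : IsBoundedBelowKernel B) : Skel (B : Set (Frac n R)) = ∅ := by
  obtain ⟨f, rfl, α, hα, h⟩ := hB
  refine Set.eq_empty_of_forall_notMem fun x hx => ?_
  have h1 : α ≤ |f.1 x|ₘ := h x
  rw [mem_skel_ker.1 hx, mabs_one] at h1
  exact absurd hα (not_lt.2 h1)

/-- By the archimedean property some power of the lower bound `α > 1` exceeds any given constant. -/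
theorem IsBoundedBelowKernel.constKer_le [MulArchimedean R] {B : Subgroup (Frac n R)}
    (hB : IsBoundedBelowKernel B) : constKer n R ≤ B := by
  obtain ⟨f, rfl, α, hα, h⟩ := hB
  refine (isKernel_ker f).kerSpan_le ?_
  rintro _ ⟨c, rfl⟩
  obtain ⟨N, hN⟩ := MulArchimedean.arch |c|ₘ hα
  exact mem_ker_iff_forall.2 ⟨N, fun x => hN.trans (pow_le_pow_left' (h x) N)⟩

end FracBasics

/-! ### Monomials along coordinate lines. -/

theorem exists_mul_pow_eq {R : Type*} [CommGroup R]
    (hdiv : ∀ (k : ℕ) (α : R), k ≠ 0 → ∃ β : R, β ^ k = α) {k l : ℕ}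
    (hkl : k ≠ l) (A B : R) : ∃ t : R, A * t ^ k = B * t ^ l := by
  have key : ∀ {k l : ℕ}, k < l → ∀ A B : R, ∃ t : R, A * t ^ k = B * t ^ l := by
    intro k l hkl A B
    obtain ⟨t, ht⟩ := hdiv (l - k) (A / B) (Nat.sub_ne_zero_of_lt hkl)
    refine ⟨t, ?_⟩
    rw [← Nat.add_sub_cancel' hkl.le, pow_add, ht, mul_comm (t ^ k), ← mul_assoc,
      mul_div_cancel]
  rcases lt_or_gt_of_ne hkl with h | h
  · exact key h A B
  · obtain ⟨t, ht⟩ := key h B A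
    exact ⟨t, ht.symm⟩

section Monomials

variable {n : ℕ} {R : Type*} [CommGroup R] [LinearOrder R]

theorem monomial_update {R : Type*} [CommGroup R] (c : R) (k : Fin n → ℕ) (x : Fin n → R)
    (i : Fin n) :
    ∃ A : R, ∀ t, c * ∏ j, Function.update x i t j ^ k j = A * t ^ k i := by
  refine ⟨c * ∏ j ∈ Finset.univ.erase i, x j ^ k j, fun t => ?_⟩
  rw [← Finset.prod_erase_mul _ _ (Finset.mem_univ i), Function.update_self, mul_assoc]
  congr 2
  refine Finset.prod_congr rfl fun j hj => ?_
  rw [Function.update_of_ne (Finset.ne_of_mem_erase hj)]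

variable [IsOrderedMonoid R]

/-- Cross-multiplication cancels `A` and `B` and leaves equal positive powers of `s` and `t` if the
exponents differ; a linearly ordered group is torsion-free. -/
theorem exponent_eq_of_eq_at_two_points {A B s t : R} {k l : ℕ} (hst : s ≠ t)
    (hs : A * s ^ k = B * s ^ l) (ht : A * t ^ k = B * t ^ l) : k = l := by
  have key : ∀ {k l : ℕ}, k < l → s ^ k * t ^ l = s ^ l * t ^ k → s = t := by
    intro k l hkl h
    obtain ⟨d, rfl⟩ := Nat.exists_eq_add_of_lt hkl
    have e : s ^ k * t ^ k * t ^ (d + 1) = s ^ k * t ^ k * s ^ (d + 1) := by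
      rw [mul_assoc, ← pow_add, ← add_assoc, h, add_assoc, pow_add, mul_right_comm]
    exact (pow_left_injective (Nat.succ_ne_zero d) (mul_left_cancel e)).symm
  have h : s ^ k * t ^ l = s ^ l * t ^ k := by
    have e : (A * s ^ k) * (B * t ^ l) = (B * s ^ l) * (A * t ^ k) := by rw [hs, ht]
    rw [mul_mul_mul_comm, mul_mul_mul_comm B, mul_comm B A, mul_left_cancel_iff] at e
    exact e
  rcases lt_trichotomy k l with hkl | hkl | hkl
  exacts [(hst (key hkl h)).elim, hkl, (hst (key hkl h.symm)).elim]

/-- A quotient of two monomials is a constant or generates a hyperplane kernel. -/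
theorem IsTropMonomial.const_or_isHPMonomial [Nontrivial R]
    (hdiv : ∀ (k : ℕ) (α : R), k ≠ 0 → ∃ β : R, β ^ k = α)
    {a h g : Frac n R} (hh : IsTropMonomial h.1) (hg : IsTropMonomial g.1) (ha : a = h / g) :
    (∃ c, a = constFrac c) ∨ IsHPMonomial a := by
  have hh' := hh
  have hg' := hg
  obtain ⟨c, k, hc⟩ := hh
  obtain ⟨d, l, hd⟩ := hg
  by_cases hkl : k = l
  · left
    refine ⟨c / d, Subtype.ext (funext fun x => ?_)⟩
    subst hkl
    rw [ha, Frac.div_apply, hc, hd]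
    exact mul_div_mul_right_eq_div _ _ _
  · right
    obtain ⟨i, hi⟩ := Function.ne_iff.1 hkl
    have eh : ∀ t, h.1 (Function.update 1 i t) = c * t ^ k i := by
      intro t
      rw [hc]
      simp [Function.update_apply]
    have eg : ∀ t, g.1 (Function.update 1 i t) = d * t ^ l i := by
      intro t
      rw [hd]
      simp [Function.update_apply]
    refine ⟨⟨h.1, g.1, hh', hg', fun e => hi ?_, by rw [ha]; rfl⟩, fun α hα => ?_⟩
    · obtain ⟨t, ht⟩ := exists_ne (1 : R)
      refine exponent_eq_of_eq_at_two_points (A := c) (B := d) ht ?_ ?_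
      · rw [← eh, ← eg, e]
      · rw [← eh, ← eg, e]
    -- Divisibility gives a point of a coordinate line where `h = g`. There every member of `ker a`
    -- takes the value 1, in particular every constant in it.
    · obtain ⟨t, ht⟩ := exists_mul_pow_eq hdiv hi c d
      have := (mem_skel_ker (x := Function.update 1 i t)).2
        (show a.1 _ = 1 by rw [ha, Frac.div_apply, eh, eg, ht, div_self'])
      exact this _ hα

end Monomials

theorem Nondegenerate.mono {n : ℕ} {R : Type*} [LinearOrder R] {Y Z : Set (Fin n → R)}
    (hY : Nondegenerate Y) (h : Y ⊆ Z) : Nondegenerate Z := by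
  obtain ⟨a, b, hab, hb⟩ := hY
  exact ⟨a, b, hab, hb.trans h⟩

/-! ### Order topology: nowhere dense hyperplanes, and regularity as a property of the skeleton. -/

section Topology

variable {n : ℕ} {R : Type*} [CommGroup R] [LinearOrder R] [IsOrderedMonoid R]

theorem denselyOrdered_of_divisible (hdiv : ∀ (k : ℕ) (α : R), k ≠ 0 → ∃ β : R, β ^ k = α) :
    DenselyOrdered R where
  dense a b hab := by
    -- The geometric mean lies strictly between.
    obtain ⟨c, hc⟩ := hdiv 2 (a * b) two_ne_zero
    refine ⟨c, ?_, ?_⟩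
    · refine lt_of_pow_lt_pow_left' 2 ?_
      rw [hc, pow_two]
      exact mul_lt_mul_right hab a
    · refine lt_of_pow_lt_pow_left' 2 ?_
      rw [hc, pow_two]
      exact mul_lt_mul_left hab b

variable [TopologicalSpace R] [OrderTopology R]

theorem IsTropMonomial.continuous {m : (Fin n → R) → R} (hm : IsTropMonomial m) :
    Continuous m := by
  obtain ⟨c, k, rfl⟩ := hm
  fun_prop

theorem IsTropPolySum.continuous {p : (Fin n → R) → R} {H : Finset ((Fin n → R) → R)}
    (hp : IsTropPolySum p H) : Continuous p := by
  obtain ⟨h1, h2, rfl⟩ := hp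
  exact Continuous.finset_sup' h2 fun i hi => (h1 i hi).continuous

theorem Frac.continuous (f : Frac n R) : Continuous f.1 := by
  obtain ⟨_, p, q, ⟨H, hp⟩, ⟨G, hq⟩, rfl⟩ := f
  exact hp.continuous.div' hq.continuous

theorem nondegenerate_iff [Nontrivial R] [DenselyOrdered R] {Z : Set (Fin n → R)} :
    Nondegenerate Z ↔ (interior Z).Nonempty := by
  constructor
  · rintro ⟨a, b, hab, hb⟩
    have ho : IsOpen (Set.univ.pi fun i => Set.Ioo (a i) (b i)) :=
      isOpen_set_pi Set.finite_univ fun i _ => isOpen_Ioo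
    choose c hc using fun i => exists_between (hab i)
    exact ⟨c, interior_maximal hb ho fun i _ => hc i⟩
  · rintro ⟨x, hx⟩
    have hZ : Z ∈ nhds x := mem_interior_iff_mem_nhds.1 hx
    rw [nhds_pi, Filter.mem_pi'] at hZ
    obtain ⟨I, t, ht, htZ⟩ := hZ
    choose u hu hut using fun i => (nhds_basis_Ioo (x i)).mem_iff.1 (ht i)
    refine ⟨fun i => (u i).1, fun i => (u i).2, fun i => (hu i).1.trans (hu i).2, ?_⟩
    exact fun y hy => htZ fun i _ => hut i (hy i trivial)

/-- Inside a box of agreement one coordinate can be moved alone, so the exponents match variable by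
variable, and then the coefficients do. -/
theorem IsTropMonomial.interior_eqLocus [Nontrivial R] [DenselyOrdered R]
    {h g : (Fin n → R) → R} (hh : IsTropMonomial h) (hg : IsTropMonomial g) (hne : h ≠ g) :
    interior {x | h x = g x} = ∅ := by
  by_contra hi
  obtain ⟨a, b, hab, hb⟩ := nondegenerate_iff.2 (Set.nonempty_iff_ne_empty.2 hi)
  choose x hx using fun i => exists_between (hab i)
  choose y hy using fun i => exists_between (hx i).2
  have hxb : h x = g x := hb fun i _ => hx i
  obtain ⟨c, k, rfl⟩ := hh
  obtain ⟨d, l, rfl⟩ := hg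
  have hkl : k = l := by
    funext i
    obtain ⟨A, hA⟩ : ∃ A : R, ∀ t, c * ∏ j, Function.update x i t j ^ k j = A * t ^ k i :=
      monomial_update c k x i
    obtain ⟨B, hB⟩ : ∃ A : R, ∀ t, d * ∏ j, Function.update x i t j ^ l j = A * t ^ l i :=
      monomial_update d l x i
    refine exponent_eq_of_eq_at_two_points (hy i).1.ne (A := A) (B := B) ?_ ?_
    · rw [← hA, ← hB, Function.update_eq_self]
      exact hxb
    · rw [← hA, ← hB]
      refine hb fun j _ => ?_
      by_cases hj : j = i
      · subst hj
        simpa using ⟨(hx j).1.trans (hy j).1, (hy j).2⟩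
      · simpa [hj] using hx j
  subst hkl
  rw [mul_right_cancel_iff] at hxb
  exact hne (by rw [hxb])

theorem IsHPFraction.interior_skel [Nontrivial R] [DenselyOrdered R] {f : Frac n R}
    (hf : IsHPFraction f) : interior (Skel (ker f : Set (Frac n R))) = ∅ := by
  obtain ⟨a, ⟨⟨h, g, hh, hg, hne, e⟩, -⟩, hfa⟩ := hf
  rw [hfa, ← hh.interior_eqLocus hg hne]
  congr 1
  ext x
  rw [mem_skel_ker, e]
  exact div_eq_one

theorem isClosed_skel_ker (f : Frac n R) : IsClosed (Skel (ker f : Set (Frac n R))) := by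
  have : Skel (ker f : Set (Frac n R)) = {x | f.1 x = 1} := Set.ext fun x => mem_skel_ker
  rw [this]
  exact isClosed_eq f.continuous continuous_const

theorem interior_biUnion_finset_eq_empty {X ι : Type*} [TopologicalSpace X] (s : Finset ι)
    {A : ι → Set X} (hc : ∀ i ∈ s, IsClosed (A i)) (hi : ∀ i ∈ s, interior (A i) = ∅) :
    interior (⋃ i ∈ s, A i) = ∅ := by
  classical
  induction s using Finset.induction_on with
  | empty => simp
  | insert i s _ ih =>
    rw [Finset.set_biUnion_insert, interior_union_isClosed_of_interior_empty
      (hc i (Finset.mem_insert_self i s))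
      (ih (fun j hj => hc j (Finset.mem_insert_of_mem hj))
        fun j hj => hi j (Finset.mem_insert_of_mem hj))]
    exact hi i (Finset.mem_insert_self i s)

/-- Regular kernels are those whose skeleton has empty interior. -/
theorem isRegularKernel_ker_iff [Nontrivial R] [DenselyOrdered R] {f : Frac n R} :
    IsRegularKernel (ker f) ↔ interior (Skel (ker f : Set (Frac n R))) = ∅ := by
  constructor
  · rintro ⟨f', ⟨h, g, H, G, hh, hg, e, hreg⟩, hff⟩
    classical
    rw [hff, ← Set.subset_empty_iff,
      -- Regularity covers the skeleton by the agreement loci of finitely many pairs of distinct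
      -- monomials.
      ← interior_biUnion_finset_eq_empty ((H ×ˢ G).filter fun t => t.1 ≠ t.2)
        (A := fun t => {x | t.1 x = t.2 x})]
    · refine interior_mono fun x hx => ?_
      rw [mem_skel_ker, e] at hx
      obtain ⟨h', hh', g', hg', e1, e2, hne⟩ := hreg x
      have e3 : h x = g x := div_eq_one.1 hx
      simp only [Set.mem_iUnion]
      exact ⟨(h', g'), by simp [hh', hg', hne], e1.symm.trans (e3.trans e2)⟩
    · intro t ht
      simp only [Finset.mem_filter, Finset.mem_product] at ht
      exact isClosed_eq (hh.1 _ ht.1.1).continuous (hg.1 _ ht.1.2).continuous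
    · intro t ht
      simp only [Finset.mem_filter, Finset.mem_product] at ht
      exact (hh.1 _ ht.1.1).interior_eqLocus (hg.1 _ ht.1.2) ht.2
  · intro hf
    refine ⟨f, ?_, rfl⟩
    obtain ⟨p, q, ⟨H, hH⟩, ⟨G, hG⟩, e⟩ := f.2
    refine ⟨p, q, H, G, hH, hG, e, fun x => ?_⟩
    have attain : ∀ {p : (Fin n → R) → R} {H}, IsTropPolySum p H → ∀ x, ∃ h ∈ H, p x = h x := by
      rintro _ H ⟨-, hne, rfl⟩ x
      rw [Finset.sup'_apply]
      exact Finset.exists_mem_eq_sup' hne fun h : (Fin n → R) → R => h x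
    -- If regularity fails at `x`, a single monomial `m` is the only dominating one for both `p` and
    -- `q`. Strict domination persists nearby, so `p = m = q` around `x`, an interior point of the
    -- skeleton.
    by_contra! hx
    obtain ⟨m, hm, em⟩ := attain hH x
    obtain ⟨m', hm', em'⟩ := attain hG x
    obtain rfl := hx m hm m' hm' em em'
    have near : ∀ {p : (Fin n → R) → R} {H}, IsTropPolySum p H → m ∈ H → p x = m x →
        (∀ h ∈ H, p x = h x → h = m) → ∀ᶠ y in nhds x, p y = m y := by
      intro p H hp hmH hpm hu
      have hle : ∀ h ∈ H, ∀ y, h y ≤ p y := by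
        obtain ⟨-, hne, rfl⟩ := hp
        exact fun h hh y => Finset.le_sup' (f := id) hh y
      have : ∀ᶠ y in nhds x, ∀ h ∈ H, h ≠ m → h y < m y := by
        rw [Filter.eventually_all_finset]
        intro h hh
        by_cases hhm : h = m
        · simp [hhm]
        have hlt : h x < m x := by
          rw [← hpm]
          exact lt_of_le_of_ne (hle h hh x) fun e => hhm (hu h hh e.symm)
        filter_upwards [(hp.1 h hh).continuous.continuousAt.eventually_lt
          (hH.1 m hm).continuous.continuousAt hlt] with y hy _
        exact hy
      filter_upwards [this] with y hy
      obtain ⟨h, hh, eh⟩ := attain hp y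
      refine le_antisymm ?_ (hle m hmH y)
      rw [eh]
      by_cases hhm : h = m
      exacts [hhm ▸ le_rfl, (hy h hh hhm).le]
    have h1 := near hH hm em fun h hh e => hx h hh m hm' e em'
    have h2 := near hG hm' em' fun g hg e => (hx m hm g hg em e).symm
    have : x ∈ interior (Skel (ker f : Set (Frac n R))) := by
      rw [mem_interior_iff_mem_nhds]
      filter_upwards [h1, h2] with y hy1 hy2
      rw [mem_skel_ker, e]
      exact div_eq_one.2 (hy1.trans hy2.symm)
    rw [hf] at this
    exact this

end Topology

/-! ### Properties valid for arbitrary decompositions, and the one-component decompositions. -/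

section Decompositions

variable {n : ℕ} {R : Type*} [CommGroup R] [LinearOrder R] [IsOrderedMonoid R]

/-- The sum of the absolute values of the order fractions `1 + g`, for `g` in a list. -/
def orderSum (l : List (Frac n R)) : Frac n R := absSum (l.map fun g => 1 ⊔ g)

/-- Lists of HP-fractions whose order fractions define a region fraction. -/
def IsRegionList (l : List (Frac n R)) : Prop :=
  (∀ g ∈ l, IsHPFraction g ∧ g ≠ 1) ∧ (∀ g ∈ l, ∀ g' ∈ l, 1 ⊔ g' ≠ 1 ⊔ g⁻¹) ∧
    Nondegenerate (Skel {orderSum l})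

theorem IsRegionList.isRegionKernel {l : List (Frac n R)} (hl : IsRegionList l) :
    IsRegionKernel (ker (orderSum l)) :=
  ⟨orderSum l, ⟨l, hl.1, hl.2.1, rfl, hl.2.2⟩, rfl⟩

theorem IsRegionList.isOrderFraction {l : List (Frac n R)} (hl : IsRegionList l) :
    ∀ o ∈ l.map (fun g => 1 ⊔ g), IsOrderFraction o := by
  intro o ho
  obtain ⟨g, hg, rfl⟩ := List.mem_map.1 ho
  exact ⟨g, (hl.1 g hg).1, (hl.1 g hg).2, rfl⟩

theorem IsHPMonomial.isHPFraction {a : Frac n R} (ha : IsHPMonomial a) : IsHPFraction a :=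
  ⟨a, ha, rfl⟩

theorem isHSKernel_ker_absSum {l : List (Frac n R)} (hl : ∀ a ∈ l, IsHPMonomial a) :
    IsHSKernel (ker (absSum l)) :=
  ⟨absSum l, ⟨l, hl, rfl⟩, rfl⟩

theorem le_orderSum {l : List (Frac n R)} {g : Frac n R} (hg : g ∈ l) : 1 ⊔ g ≤ orderSum l :=
  (le_mabs_self _).trans (mabs_le_absSum (List.mem_map.2 ⟨g, hg, rfl⟩))

theorem orderSum_apply_eq_one {l : List (Frac n R)} {x : Fin n → R}
    (h : ∀ g ∈ l, g.1 x ≤ 1) : (orderSum l).1 x = 1 := by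
  induction l with
  | nil => rfl
  | cons g l ih =>
    have e : (orderSum (g :: l)).1 x = |1 ⊔ g.1 x|ₘ ⊔ (orderSum l).1 x := rfl
    rw [e, ih fun g hg => h g (List.mem_cons_of_mem _ hg),
      sup_eq_left.2 (h g List.mem_cons_self), mabs_one, sup_idem]

theorem isRegionList_nil [Nontrivial R] : IsRegionList ([] : List (Frac n R)) := by
  refine ⟨by simp, by simp, ?_⟩
  obtain ⟨a, b, hab⟩ := exists_pair_lt R
  exact ⟨fun _ => a, fun _ => b, fun _ => hab, fun x _ f hf => by rw [hf]; rfl⟩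

theorem IsRegionKernel.nondegenerate {K : Subgroup (Frac n R)} (hK : IsRegionKernel K) :
    Nondegenerate (Skel (K : Set (Frac n R))) := by
  obtain ⟨r, ⟨l, -, -, -, hr⟩, rfl⟩ := hK
  rwa [← skel_singleton]

/-- A decomposition from explicit lists of generators. -/
theorem nonempty_hoDecomposition {M : Subgroup (Frac n R)}
    (TK : List (List (Frac n R) × List (Frac n R))) (TN : List (Frac n R × List (Frac n R)))
    (hK : ∀ t ∈ TK, (∀ a ∈ t.1, IsHPMonomial a) ∧ IsRegionList t.2)
    (hN : ∀ t ∈ TN, IsBoundedBelowKernel (ker t.1) ∧ IsRegionList t.2)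
    (hM : ∀ u, u ∈ M ↔ (∀ t ∈ TK, u ∈ ker (absSum t.1) ⊔ ker (orderSum t.2)) ∧
      ∀ t ∈ TN, u ∈ ker t.1 ⊔ ker (orderSum t.2)) :
    Nonempty (HODecomposition M) :=
  ⟨{ s := TK.length
     m := TN.length
     L := fun i => ker (absSum (TK.get i).1)
     Rg := fun i => ker (orderSum (TK.get i).2)
     B := fun i => ker (TN.get i).1
     Q := fun i => ker (orderSum (TN.get i).2)
     hp := fun i => (TK.get i).1
     ord := fun i => (TK.get i).2.map fun g => 1 ⊔ g
     isHS_L := fun i => isHSKernel_ker_absSum (hK _ (List.get_mem _ i)).1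
     isHP_hp := fun i a ha => ((hK _ (List.get_mem _ i)).1 a ha).isHPFraction
     L_eq := fun _ => ker_absSum _
     isRegion_Rg := fun i => (hK _ (List.get_mem _ i)).2.isRegionKernel
     isOrder_ord := fun i => (hK _ (List.get_mem _ i)).2.isOrderFraction
     Rg_eq := fun _ => ker_absSum _
     isBoundedBelow_B := fun i => (hN _ (List.get_mem _ i)).1
     isRegion_Q := fun i => (hN _ (List.get_mem _ i)).2.isRegionKernel
     isPrincipal_K := fun _ => ⟨_, ker_sup_ker _ _⟩
     isPrincipal_N := fun _ => ⟨_, ker_sup_ker _ _⟩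
     eq_inf := by
      ext u
      rw [hM, Subgroup.mem_inf, Subgroup.mem_iInf, Subgroup.mem_iInf,
        List.forall_mem_iff_get, List.forall_mem_iff_get] }⟩

/-- An HS-kernel is the only component of one of its decompositions. -/
theorem IsHSKernel.exists_hoDecomposition [Nontrivial R] {M : Subgroup (Frac n R)}
    (hM : IsHSKernel M) : ∃ D : HODecomposition M, D.s = 1 ∧ D.m = 0 ∧
      ∀ i, D.ord i = [] ∧ D.K i = D.L i ∧ D.L i = M := by
  have hM' := hM
  obtain ⟨f, ⟨l, hl, e⟩, rfl⟩ := hM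
  refine ⟨{ s := 1
            m := 0
            L := fun _ => ker f
            Rg := fun _ => ker (orderSum [])
            B := Fin.elim0
            Q := Fin.elim0
            hp := fun _ => l
            ord := fun _ => []
            isHS_L := fun _ => hM'
            isHP_hp := fun _ a ha => (hl a ha).isHPFraction
            L_eq := fun _ => by rw [e, ker_absSum]
            isRegion_Rg := fun _ => isRegionList_nil.isRegionKernel
            isOrder_ord := by simp
            Rg_eq := fun _ => ker_absSum _
            isBoundedBelow_B := fun j => j.elim0
            isRegion_Q := fun j => j.elim0
            isPrincipal_K := fun _ => ⟨_, ker_sup_ker _ _⟩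
            isPrincipal_N := fun j => j.elim0
            eq_inf := ?_ }, rfl, rfl, fun _ => ⟨rfl, ?_, rfl⟩⟩
  · simp [orderSum, absSum, ker_one, iInf_of_empty]
  · simp [HODecomposition.K, orderSum, absSum, ker_one]

/-- A region kernel is the only component of one of its decompositions. -/
theorem IsRegionKernel.exists_hoDecomposition {M : Subgroup (Frac n R)}
    (hM : IsRegionKernel M) : ∃ D : HODecomposition M, D.s = 1 ∧ D.m = 0 ∧
      ∀ i, D.hp i = [] ∧ D.K i = D.Rg i ∧ D.Rg i = M := by
  have hM' := hM
  obtain ⟨f, ⟨l, hl, -, e, -⟩, rfl⟩ := hM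
  refine ⟨{ s := 1
            m := 0
            L := fun _ => ker (absSum [])
            Rg := fun _ => ker f
            B := Fin.elim0
            Q := Fin.elim0
            hp := fun _ => []
            ord := fun _ => l.map fun g => 1 ⊔ g
            isHS_L := fun _ => isHSKernel_ker_absSum (by simp)
            isHP_hp := by simp
            L_eq := fun _ => ker_absSum _
            isRegion_Rg := fun _ => hM'
            isOrder_ord := fun _ o ho => by
              obtain ⟨g, hg, rfl⟩ := List.mem_map.1 ho
              exact ⟨g, (hl g hg).1, (hl g hg).2, rfl⟩
            Rg_eq := fun _ => by rw [e, ker_absSum]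
            isBoundedBelow_B := fun j => j.elim0
            isRegion_Q := fun j => j.elim0
            isPrincipal_K := fun _ => ⟨_, ker_sup_ker _ _⟩
            isPrincipal_N := fun j => j.elim0
            eq_inf := ?_ }, rfl, rfl, fun _ => ⟨rfl, ?_, rfl⟩⟩
  · simp [absSum, ker_one, iInf_of_empty]
  · simp [HODecomposition.K, absSum, ker_one]

theorem HODecomposition.eq_inf_constKer [MulArchimedean R] {M : Subgroup (Frac n R)}
    (D : HODecomposition M) (hM : M ≤ constKer n R) :
    M = (⨅ i, D.K i) ⊓ ⨅ _j : Fin D.m, constKer n R := by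
  refine le_antisymm (le_inf ?_ (le_iInf fun _ => hM)) ?_
  · exact D.eq_inf.le.trans inf_le_left
  · refine le_trans (inf_le_inf_left _ (iInf_mono fun j => ?_)) D.eq_inf.ge
    exact (D.isBoundedBelow_B j).constKer_le.trans le_sup_left

theorem HODecomposition.K_eq_of_hp_eq_nil {M : Subgroup (Frac n R)} (D : HODecomposition M)
    {i : Fin D.s} (h : D.hp i = []) : D.K i = D.Rg i := by
  have : D.L i = ⊥ := by simp [D.L_eq i, h]
  rw [HODecomposition.K, this, bot_sup_eq]

/-- The components `Nⱼ` contribute no points: their bounded factors already have empty skeleton. -/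
theorem HODecomposition.skel_subset [Nontrivial R] {M : Subgroup (Frac n R)}
    (D : HODecomposition M) :
    Skel (M : Set (Frac n R)) ⊆ ⋃ i, Skel (D.K i : Set (Frac n R)) := by
  intro x hx
  have principal_isKernel : ∀ {K : Subgroup (Frac n R)}, IsPrincipalKernel K → IsKernel K := by
    rintro _ ⟨f, rfl⟩
    exact isKernel_ker f
  have kK := fun i => principal_isKernel (D.isPrincipal_K i)
  have kN := fun j => principal_isKernel (D.isPrincipal_N j)
  rw [D.eq_inf] at hx
  rcases mem_skel_inf (isKernel_iInf kK) (isKernel_iInf kN) hx with h | h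
  · exact Set.mem_iUnion.2 (mem_skel_iInf kK h)
  · obtain ⟨j, hj⟩ := mem_skel_iInf kN h
    have : x ∈ Skel (D.B j : Set (Frac n R)) :=
      Skel.mono (SetLike.coe_subset_coe.2 le_sup_left) hj
    rw [(D.isBoundedBelow_B j).skel_eq_empty] at this
    exact this.elim

variable [TopologicalSpace R] [OrderTopology R] [Nontrivial R] [DenselyOrdered R]

/-- Here `ker f ≤ Rg i`, and passing to skeletons reverses inclusion, so the skeleton of `f`
contains a box. -/
theorem HODecomposition.not_isRegularKernel {f : Frac n R} (D : HODecomposition (ker f))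
    {i : Fin D.s} (h : D.K i = D.Rg i) : ¬ IsRegularKernel (ker f) := by
  rw [isRegularKernel_ker_iff, ← Set.not_nonempty_iff_eq_empty, not_not, ← nondegenerate_iff]
  refine (D.isRegion_Rg i).nondegenerate.mono (Skel.mono (SetLike.coe_subset_coe.2 ?_))
  rw [← h]
  exact D.eq_inf.le.trans (inf_le_left.trans (iInf_le _ i))

/-- One HP-factor per component suffices: it confines the skeleton of that component to a closed set
with empty interior, and finitely many of these cover the skeleton of `f`. -/
theorem HODecomposition.isRegularKernel {f : Frac n R} (D : HODecomposition (ker f))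
    (h : ∀ i, D.hp i ≠ []) : IsRegularKernel (ker f) := by
  rw [isRegularKernel_ker_iff, ← Set.subset_empty_iff]
  choose a ha using fun i => List.exists_mem_of_ne_nil _ (h i)
  rw [← interior_biUnion_finset_eq_empty Finset.univ
    (A := fun i => Skel (ker (a i) : Set (Frac n R)))
    (fun i _ => isClosed_skel_ker (a i)) fun i _ => (D.isHP_hp i _ (ha i)).interior_skel]
  refine interior_mono (D.skel_subset.trans ?_)
  simp only [Finset.mem_univ, Set.iUnion_true]
  refine Set.iUnion_mono fun i => Skel.mono (SetLike.coe_subset_coe.2 ?_)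
  refine le_trans ?_ (le_sup_left : D.L i ≤ D.K i)
  rw [D.L_eq i]
  exact le_iSup₂_of_le (a i) (ha i) le_rfl

theorem HODecomposition.isRegularKernel_iff {f : Frac n R} (D : HODecomposition (ker f)) :
    (¬ IsRegularKernel (ker f) ↔ ∃ i, D.K i = D.Rg i) ∧
      (IsRegularKernel (ker f) ↔ ∀ i, D.hp i ≠ []) := by
  have h1 : ¬ IsRegularKernel (ker f) → ∃ i, D.hp i = [] := fun h => by
    by_contra! h'
    exact h (D.isRegularKernel h')
  refine ⟨⟨fun h => ?_, fun ⟨i, hi⟩ => D.not_isRegularKernel hi⟩,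
    fun h i hi => ?_, D.isRegularKernel⟩
  · obtain ⟨i, hi⟩ := h1 h
    exact ⟨i, D.K_eq_of_hp_eq_nil hi⟩
  · exact D.not_isRegularKernel (D.K_eq_of_hp_eq_nil hi) h

end Decompositions

/-! ### Construction of a decomposition from domination loci. -/

section Existence

/-- The complement of the members with nonempty interior is open and covered by finitely many closed
sets with empty interior, hence empty. -/
theorem exists_mem_nonempty_interior {X ι : Type*} [TopologicalSpace X] (s : Finset ι)
    {A : ι → Set X} (hc : ∀ i ∈ s, IsClosed (A i)) (hA : ∀ x, ∃ i ∈ s, x ∈ A i) (x : X) :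
    ∃ i ∈ s, x ∈ A i ∧ (interior (A i)).Nonempty := by
  classical
  by_contra! hx
  have ho : IsOpen (⋃ i ∈ s.filter fun i => (interior (A i)).Nonempty, A i)ᶜ :=
    (isClosed_biUnion_finset fun i hi => hc i (Finset.mem_filter.1 hi).1).isOpen_compl
  have hsub : (⋃ i ∈ s.filter fun i => (interior (A i)).Nonempty, A i)ᶜ ⊆
      ⋃ i ∈ s.filter fun i => interior (A i) = ∅, A i := by
    intro y hy
    obtain ⟨i, hi, hyi⟩ := hA y
    simp only [Set.mem_compl_iff, Set.mem_iUnion, Finset.mem_filter, not_exists] at hy ⊢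
    refine ⟨i, ⟨hi, ?_⟩, hyi⟩
    by_contra hne
    exact hy i ⟨hi, Set.nonempty_iff_ne_empty.2 hne⟩ hyi
  have h0 := interior_maximal hsub ho
  rw [interior_biUnion_finset_eq_empty _ (fun i hi => hc i (Finset.mem_filter.1 hi).1)
    fun i hi => (Finset.mem_filter.1 hi).2] at h0
  refine h0 (a := x) ?_
  simp only [Set.mem_compl_iff, Set.mem_iUnion, Finset.mem_filter, not_exists]
  exact fun i hi hxi => (hx i hi.1 hxi ▸ hi.2).ne_empty rfl

variable {n : ℕ} {R : Type*} [CommGroup R] [LinearOrder R] [IsOrderedMonoid R]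

/-- `p` is the sum of the nonempty list `H` of monomials, inside the semifield of fractions. -/
def IsMonomialSum (p : Frac n R) (H : List (Frac n R)) : Prop :=
  (∀ h ∈ H, IsTropMonomial h.1 ∧ h ≤ p) ∧ ∀ x, ∃ h ∈ H, p.1 x = h.1 x

theorem IsTropPoly.exists_isMonomialSum {p : (Fin n → R) → R} (hp : IsTropPoly p) :
    ∃ H, IsMonomialSum (⟨p, hp.mem_frac⟩ : Frac n R) H := by
  obtain ⟨H, hH, hne, rfl⟩ := id hp
  refine ⟨H.attach.toList.map fun h => ⟨h.1, (hH h.1 h.2).isTropPoly.mem_frac⟩, ?_, fun x => ?_⟩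
  · intro h hh
    obtain ⟨⟨m, hm⟩, -, rfl⟩ := List.mem_map.1 hh
    exact ⟨hH m hm, Finset.le_sup' (f := id) hm⟩
  · obtain ⟨m, hm, e⟩ := Finset.exists_mem_eq_sup' hne fun h : (Fin n → R) → R => h x
    refine ⟨⟨m, (hH m hm).isTropPoly.mem_frac⟩, ?_, ?_⟩
    · exact List.mem_map.2 ⟨⟨m, hm⟩, by simp, rfl⟩
    · exact (Finset.sup'_apply hne id x).trans e

theorem Frac.exists_monomialSums (f : Frac n R) :
    ∃ p q : Frac n R, ∃ H G, IsMonomialSum p H ∧ IsMonomialSum q G ∧ f = p / q := by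
  obtain ⟨p, q, hp, hq, e⟩ := f.2
  obtain ⟨H, hH⟩ := hp.exists_isMonomialSum
  obtain ⟨G, hG⟩ := hq.exists_isMonomialSum
  exact ⟨_, _, H, G, hH, hG, Subtype.ext e⟩

open Classical in
/-- The nonconstant quotients `h' / h`, for `h'` in a list of monomials. -/
noncomputable def hpRatios (H : List (Frac n R)) (h : Frac n R) : List (Frac n R) :=
  (H.map (· / h)).filter fun a => IsHPMonomial a

theorem mem_hpRatios {H : List (Frac n R)} {h a : Frac n R} :
    a ∈ hpRatios H h ↔ (∃ h' ∈ H, h' / h = a) ∧ IsHPMonomial a := by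
  simp only [hpRatios, List.mem_filter, List.mem_map, decide_eq_true_eq]

theorem IsMonomialSum.hpRatios_apply_le_one {p h : Frac n R} {H : List (Frac n R)}
    (hp : IsMonomialSum p H) {x : Fin n → R} (hx : p.1 x = h.1 x) :
    ∀ a ∈ hpRatios H h, a.1 x ≤ 1 := by
  intro a ha
  obtain ⟨⟨h', hh', rfl⟩, -⟩ := mem_hpRatios.1 ha
  rw [Frac.div_apply, div_le_one', ← hx]
  exact (hp.1 h' hh').2 x

/-- At each point `p / h` equals some ratio `h' / h`. A nonconstant ratio is bounded by its order
fraction; a constant one is at most 1, as the point `y` where `h` dominates shows. This is why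
constant ratios may be omitted from `hpRatios`. -/
theorem IsMonomialSum.mabs_div_le [Nontrivial R]
    (hdiv : ∀ (k : ℕ) (α : R), k ≠ 0 → ∃ β : R, β ^ k = α) {p h : Frac n R}
    {H : List (Frac n R)} (hp : IsMonomialSum p H) (hh : h ∈ H) {y : Fin n → R}
    (hy : p.1 y = h.1 y) {l : List (Frac n R)} (hl : hpRatios H h ⊆ l) :
    |p / h|ₘ ≤ orderSum l := by
  rw [mabs_of_one_le (one_le_div'.2 (hp.1 h hh).2)]
  intro x
  obtain ⟨h', hh', e⟩ := hp.2 x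
  have e' : (p / h).1 x = (h' / h).1 x := by rw [Frac.div_apply, e]; rfl
  rw [e']
  rcases (hp.1 h' hh').1.const_or_isHPMonomial hdiv (hp.1 h hh).1 rfl with ⟨c, hc⟩ | ha
  · have h1 : (h' / h).1 y ≤ 1 := by
      rw [Frac.div_apply, div_le_one', ← hy]
      exact (hp.1 h' hh').2 y
    rw [hc] at h1 ⊢
    have h2 : (1 : Frac n R) ≤ orderSum l := one_le_absSum _
    exact le_trans h1 (h2 x)
  · have := le_orderSum (hl (mem_hpRatios.2 ⟨⟨h', hh', rfl⟩, ha⟩)) x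
    exact le_trans le_sup_right this

variable [TopologicalSpace R] [OrderTopology R]

/-- The locus where `h` and `g` are the dominating monomials of `p` and `q`. -/
def dominationLocus (p q : Frac n R) (t : Frac n R × Frac n R) : Set (Fin n → R) :=
  {x | p.1 x = t.1.1 x ∧ q.1 x = t.2.1 x}

theorem isClosed_dominationLocus (p q : Frac n R) (t : Frac n R × Frac n R) :
    IsClosed (dominationLocus p q t) :=
  (isClosed_eq p.continuous t.1.continuous).inter (isClosed_eq q.continuous t.2.continuous)

variable [Nontrivial R]

/-- Forward, `p / q = (p / h) * (h / g) / (q / g)`, whose outer factors are controlled by the region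
fraction. Backward, that fraction is 1 on its locus, so the bound on `u` there involves only `h / g
= p / q`; the largest of the finitely many exponents works everywhere. -/
theorem mem_ker_iff_forall_dominationLocus
    (hdiv : ∀ (k : ℕ) (α : R), k ≠ 0 → ∃ β : R, β ^ k = α)
    {p q : Frac n R} {H G : List (Frac n R)} (hp : IsMonomialSum p H) (hq : IsMonomialSum q G)
    (u : Frac n R) :
    u ∈ ker (p / q) ↔ ∀ t ∈ H ×ˢ G, (interior (dominationLocus p q t)).Nonempty →
      u ∈ ker (t.1 / t.2) ⊔ ker (orderSum (hpRatios H t.1 ++ hpRatios G t.2)) := by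
  classical
  constructor
  · intro hu t ht hint
    obtain ⟨hh, hg⟩ := List.mem_product.1 ht
    obtain ⟨y, hy⟩ := hint.mono interior_subset
    set r := orderSum (hpRatios H t.1 ++ hpRatios G t.2) with hr
    have h1 : |p / t.1|ₘ ≤ r := hp.mabs_div_le hdiv hh hy.1 (List.subset_append_left _ _)
    have h2 : |q / t.2|ₘ ≤ r := hq.mabs_div_le hdiv hg hy.2 (List.subset_append_right _ _)
    rw [ker_sup_ker]
    have kr : r ∈ ker (t.1 / t.2) ⊔ ker r := Subgroup.mem_sup_right (mem_ker_self r)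
    rw [ker_sup_ker] at kr
    have ka : t.1 / t.2 ∈ ker (t.1 / t.2) ⊔ ker r := Subgroup.mem_sup_left (mem_ker_self _)
    rw [ker_sup_ker] at ka
    refine (isKernel_ker _).ker_le ?_ hu
    have e : p / q = (p / t.1) * (t.1 / t.2) / (q / t.2) := by
      rw [div_mul_div_cancel, div_div_div_cancel_right]
    rw [e]
    exact div_mem (mul_mem ((isKernel_ker _).mem_of_mabs_le kr h1) ka)
      ((isKernel_ker _).mem_of_mabs_le kr h2)
  · intro hu
    have h1 : ∀ t ∈ H ×ˢ G, ∃ N : ℕ, (interior (dominationLocus p q t)).Nonempty →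
        ∀ x ∈ dominationLocus p q t, |u.1 x|ₘ ≤ |(p / q).1 x|ₘ ^ N := by
      intro t ht
      by_cases hint : (interior (dominationLocus p q t)).Nonempty
      swap
      · exact ⟨0, fun h => (hint h).elim⟩
      have h2 := hu t ht hint
      rw [ker_sup_ker, mem_ker_iff_forall] at h2
      obtain ⟨N, hN⟩ := h2
      refine ⟨N, fun _ x hx => (hN x).trans (le_of_eq ?_)⟩
      have e1 : (orderSum (hpRatios H t.1 ++ hpRatios G t.2)).1 x = 1 := by
        refine orderSum_apply_eq_one fun a ha => ?_
        rcases List.mem_append.1 ha with h | h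
        exacts [hp.hpRatios_apply_le_one hx.1 a h, hq.hpRatios_apply_le_one hx.2 a h]
      rw [Frac.sup_apply, Frac.mabs_apply, Frac.mabs_apply, e1, mabs_one,
        sup_eq_left.2 (one_le_mabs _), mabs_mabs, Frac.div_apply, Frac.div_apply, hx.1, hx.2]
    choose! N hN using h1
    refine mem_ker_iff_forall.2 ⟨(H ×ˢ G).toFinset.sup N, fun x => ?_⟩
    obtain ⟨t, ht, hxt, hint⟩ := exists_mem_nonempty_interior (H ×ˢ G).toFinset
      (A := dominationLocus p q) (fun t _ => isClosed_dominationLocus p q t) (fun x => by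
        obtain ⟨h, hh, e⟩ := hp.2 x
        obtain ⟨g, hg, e'⟩ := hq.2 x
        exact ⟨(h, g), List.mem_toFinset.2 (List.mem_product.2 ⟨hh, hg⟩), e, e'⟩) x
    exact (hN t (List.mem_toFinset.1 ht) hint x hxt).trans
      (pow_le_pow_right' (one_le_mabs _) (Finset.le_sup ht))

variable [DenselyOrdered R]

/-- A set with interior is not contained in the skeleton of an HP-kernel, so each `a` is strictly
below 1 somewhere on `P`. At such a point `1 ⊔ a⁻¹` exceeds 1 while all the order fractions equal 1,
so none is complementary to another. -/
theorem isRegionList_of_apply_le_one {l : List (Frac n R)} (hl : ∀ a ∈ l, IsHPMonomial a)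
    {P : Set (Fin n → R)} (hP : (interior P).Nonempty) (hlP : ∀ x ∈ P, ∀ a ∈ l, a.1 x ≤ 1) :
    IsRegionList l := by
  have key : ∀ a ∈ l, ∃ x ∈ P, a.1 x ≠ 1 := by
    intro a ha
    by_contra! h
    have h1 : P ⊆ Skel (ker a : Set (Frac n R)) := fun x hx => mem_skel_ker.2 (h x hx)
    have h2 := interior_mono h1
    rw [(hl a ha).isHPFraction.interior_skel] at h2
    exact hP.ne_empty (Set.subset_empty_iff.1 h2)
  refine ⟨fun g hg => ⟨(hl g hg).isHPFraction, ?_⟩, fun g hg g' hg' e => ?_, ?_⟩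
  · rintro rfl
    obtain ⟨x, -, hx⟩ := key 1 hg
    exact hx rfl
  · obtain ⟨x, hxP, hx⟩ := key g hg
    have e1 : (1 : R) ⊔ g'.1 x = 1 ⊔ (g.1 x)⁻¹ := congrFun (congrArg Subtype.val e) x
    rw [sup_eq_left.2 (hlP x hxP g' hg')] at e1
    have e2 : (g.1 x)⁻¹ ≤ 1 := sup_eq_left.1 e1.symm
    exact hx (le_antisymm (hlP x hxP g hg) (inv_le_one'.1 e2))
  · refine (nondegenerate_iff.2 hP).mono fun x hx => ?_
    rw [skel_singleton, mem_skel_ker]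
    exact orderSum_apply_eq_one (hlP x hx)

theorem Frac.nonempty_hoDecomposition
    (hdiv : ∀ (k : ℕ) (α : R), k ≠ 0 → ∃ β : R, β ^ k = α) (f : Frac n R) :
    Nonempty (HODecomposition (ker f)) := by
  classical
  obtain ⟨p, q, H, G, hp, hq, rfl⟩ := f.exists_monomialSums
  let T := (H ×ˢ G).filter fun t => (interior (dominationLocus p q t)).Nonempty
  let r : Frac n R × Frac n R → List (Frac n R) := fun t => hpRatios H t.1 ++ hpRatios G t.2
  -- Pairs in `C` give the bounded components. A quotient equal to 1 is kept among the `Kᵢ`, with an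
  -- empty list of HP-factors.
  let C : Frac n R × Frac n R → Prop := fun t => ∃ c : R, c ≠ 1 ∧ t.1 / t.2 = constFrac c
  have hT : ∀ t ∈ T, (t.1 ∈ H ∧ t.2 ∈ G) ∧ (interior (dominationLocus p q t)).Nonempty := by
    intro t ht
    obtain ⟨h1, h2⟩ := List.mem_filter.1 ht
    exact ⟨List.mem_product.1 h1, by simpa using h2⟩
  have hr : ∀ t ∈ T, IsRegionList (r t) := by
    intro t ht
    refine isRegionList_of_apply_le_one (fun a ha => ?_) (hT t ht).2 fun x hx a ha => ?_
    · rcases List.mem_append.1 ha with h | h <;> exact (mem_hpRatios.1 h).2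
    · rcases List.mem_append.1 ha with h | h
      exacts [hp.hpRatios_apply_le_one hx.1 a h, hq.hpRatios_apply_le_one hx.2 a h]
  have hker : ∀ a : Frac n R, ker (absSum (if a = 1 then [] else [a])) = ker a := by
    intro a
    split_ifs with h
    · rw [h]; rfl
    · simp [ker_absSum]
  refine _root_.nonempty_hoDecomposition
    ((T.filter fun t => ¬ C t).map fun t => (if t.1 / t.2 = 1 then [] else [t.1 / t.2], r t))
    ((T.filter C).map fun t => (t.1 / t.2, r t)) ?_ ?_ fun u => ?_
  · intro s hs
    obtain ⟨t, ht, rfl⟩ := List.mem_map.1 hs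
    simp only [List.mem_filter, decide_eq_true_eq] at ht
    refine ⟨fun a ha => ?_, hr t ht.1⟩
    dsimp only at ha
    split_ifs at ha with h1
    · simp at ha
    · obtain rfl := List.mem_singleton.1 ha
      obtain ⟨⟨hh, hg⟩, -⟩ := hT t ht.1
      rcases (hp.1 _ hh).1.const_or_isHPMonomial hdiv (hq.1 _ hg).1 rfl with ⟨c, hc⟩ | h
      · exact (ht.2 ⟨c, fun h => h1 (by rw [hc, h]; rfl), hc⟩).elim
      · exact h
  · intro s hs
    obtain ⟨t, ht, rfl⟩ := List.mem_map.1 hs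
    simp only [List.mem_filter, decide_eq_true_eq] at ht
    refine ⟨?_, hr t ht.1⟩
    obtain ⟨c, hc1, hc⟩ := ht.2
    exact ⟨t.1 / t.2, rfl, |c|ₘ, one_lt_mabs.2 hc1, by rw [hc]; exact fun x => le_rfl⟩
  · rw [mem_ker_iff_forall_dominationLocus hdiv hp hq]
    simp only [List.forall_mem_map, hker, List.mem_filter, decide_eq_true_eq, T, r]
    constructor
    · exact fun h => ⟨fun t ht => h t ht.1.1 ht.1.2, fun t ht => h t ht.1.1 ht.1.2⟩
    · intro h t ht hint
      by_cases hC : C t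
      exacts [h.2 t ⟨⟨ht, hint⟩, hC⟩, h.1 t ⟨⟨ht, hint⟩, hC⟩]

end Existence

theorem mainTheorem6 {R : Type*} [CommGroup R] [ConditionallyCompleteLinearOrder R]
    [IsOrderedMonoid R] [MulArchimedean R] [Nontrivial R]
    (hdiv : ∀ (k : ℕ) (α : R), k ≠ 0 → ∃ β : R, β ^ k = α)
    (n : ℕ) (f : Frac n R) :
    Nonempty (HODecomposition (ker f)) ∧
    (ker f ≤ constKer n R → ∀ D : HODecomposition (ker f),
      ker f = (⨅ i, D.K i) ⊓ ⨅ _j : Fin D.m, constKer n R) ∧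
    (IsHSKernel (ker f) → ∃ D : HODecomposition (ker f), D.s = 1 ∧ D.m = 0 ∧
      ∀ i, D.ord i = [] ∧ D.K i = D.L i ∧ D.L i = ker f) ∧
    (IsRegionKernel (ker f) → ∃ D : HODecomposition (ker f), D.s = 1 ∧ D.m = 0 ∧
      ∀ i, D.hp i = [] ∧ D.K i = D.Rg i ∧ D.Rg i = ker f) ∧
    (∀ D : HODecomposition (ker f),
      (¬ IsRegularKernel (ker f) ↔ ∃ i, D.K i = D.Rg i) ∧
      (IsRegularKernel (ker f) ↔ ∀ i, D.hp i ≠ [])) := by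
  let : TopologicalSpace R := Preorder.topology R
  have : OrderTopology R := ⟨rfl⟩
  have : DenselyOrdered R := denselyOrdered_of_divisible hdiv
  exact ⟨f.nonempty_hoDecomposition hdiv, fun h D => D.eq_inf_constKer h,
    IsHSKernel.exists_hoDecomposition, IsRegionKernel.exists_hoDecomposition,
    fun D => D.isRegularKernel_iff⟩
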